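/- Let $(\Omega,\mu)$ be a $\sigma$-finite measure space with non-atomic $\mu$, and let $\mathcal M(\Omega,\mu)$ be the space of ($\mu$-a.e. classes of) real- or complex-valued $\mu$-measurable functions on $\Omega$. For $f\in\mathcal M(\Omega,\mu)$ and $t>0$ let $f^*(t)=\inf\{s\ge 0:\mu\{|f|>s\}\le t\}$ be its non-increasing rearrangement. For $0<q\le\infty$ let $\|\cdot\|_{q,(c,d)}$ be the usual (quasi-)norm of $L_q(c,d)$; put $1/\infty=0$ and $1/0=\infty$. Let $L_\kappa=L_\kappa(\Omega,\mu)$ and $L_\infty=L_\infty(\Omega,\mu)$ be the Lebesgue spaces, and let $L_{\kappa,\infty}$ be the space of all $f\in\mathcal M(\Omega,\mu)$ with $\sup_{t>0}t^{1/\kappa}f^*(t)<\infty$, with this supremum as quasi-norm. A function $b:(0,\infty)\to(0,\infty)$ is slowly varying, $b\in SV$, if it is Lebesgue measurable and, for every $\varepsilon>0$, $t^{\varepsilon}b(t)$ is equivalent to a non-decreasing positive function and $t^{-\varepsilon}b(t)$ to a non-increasing positive function on $(0,\infty)$ (equivalent: each is bounded by a constant multiple of the other). For a couple $(A_0,A_1)$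 of such spaces and $t>0$ let $$K(t,f;A_0,A_1)=\inf\{\|f_0\|_{A_0}+t\|f_1\|_{A_1}: f=f_0+f_1,\ f_i\in A_i\},$$ and for $a,b\in SV$ and $0<q,r\le\infty$ let $(A_0,A_1)^{\mathcal L}_{\theta,r,b,q,a}$ be the set of all $f\in A_0+A_1$ with $$\Big\|t^{-1/r}b(t)\,\big\|u^{-\theta-1/q}a(u)K(u,f;A_0,A_1)\big\|_{q,(0,t)}\Big\|_{r,(0,\infty)}<\infty .$$ For $0<p\le\infty$ let $L^{\mathcal L}_{p,r,b,q,a}$ be the set of all $f\in\mathcal M(\Omega,\mu)$ with $$\Big\|t^{-1/r}b(t)\,\big\|u^{1/p-1/q}a(u)f^*(u)\big\|_{q,(0,t)}\Big\|_{r,(0,\infty)}<\infty ,$$ and let $L^{(p,q,r}_{b}$ (the small Lorentz–Karamata space) be the set of all $f\in\mathcal M(\Omega,\mu)$ with $$\Big\|t^{-1/r}b(t)\,\big\|u^{1/p-1/q}f^*(u)\big\|_{q,(0,t)}\Big\|_{r,(0,\infty)}<\infty .$$ In each case the displayed expression is the quasi-norm of the space. **Theorem.** Let $0<\theta\le1$,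 $0<\kappa<\infty$, $p=\frac{\kappa}{1-\theta}$ (so $p=\infty$ if $\theta=1$), $0<q,r\le\infty$ and $a,b\in SV$. Put $\tilde a(t)=a(t^{1/\kappa})$ and $\tilde b(t)=b(t^{1/\kappa})$. Then $$(L_\kappa,L_\infty)^{\mathcal L}_{\theta,r,b,q,a}=(L_{\kappa,\infty},L_\infty)^{\mathcal L}_{\theta,r,b,q,a}=L^{\mathcal L}_{p,r,\tilde b,q,\tilde a},$$ and in particular, for $a\equiv1$, $$(L_\kappa,L_\infty)^{\mathcal L}_{\theta,r,b,q,1}=(L_{\kappa,\infty},L_\infty)^{\mathcal L}_{\theta,r,b,q,1}=L^{(p,q,r}_{\tilde b}.$$ Here equality means that the spaces coincide as sets and that their quasi-norms are equivalent. -/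

import Mathlib

open MeasureTheory Set
open scoped ENNReal NNReal

namespace LorentzKaramata

noncomputable section

/-! ### Slowly varying functions on `(0, ∞)` -/

/-- `f ≈ g` for two positive functions on `(0, ∞)`. -/
def EquivOnPos (f g : ℝ → ℝ) : Prop :=
  ∃ c C : ℝ, 0 < c ∧ 0 < C ∧ ∀ t ∈ Ioi (0 : ℝ), c * g t ≤ f t ∧ f t ≤ C * g t

/-- `b ∈ SV`: `b` is positive and Lebesgue measurable on `(0, ∞)` and, for every `ε > 0`,
`t ^ ε * b t` is equivalent to a non-decreasing positive function and `t ^ (-ε) * b t` to a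
non-increasing positive function. Only the values of `b` on `(0, ∞)` matter. -/
structure SlowlyVarying (b : ℝ → ℝ) : Prop where
  aemeasurable : AEMeasurable b (volume.restrict (Ioi 0))
  pos : ∀ t ∈ Ioi (0 : ℝ), 0 < b t
  equiv_mono : ∀ ε : ℝ, 0 < ε → ∃ g : ℝ → ℝ, (∀ t ∈ Ioi (0 : ℝ), 0 < g t) ∧
    MonotoneOn g (Ioi 0) ∧ EquivOnPos (fun t => t ^ ε * b t) g
  equiv_anti : ∀ ε : ℝ, 0 < ε → ∃ g : ℝ → ℝ, (∀ t ∈ Ioi (0 : ℝ), 0 < g t) ∧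
    AntitoneOn g (Ioi 0) ∧ EquivOnPos (fun t => t ^ (-ε) * b t) g

/-! ### Norms of functions on intervals -/

/-- The (quasi-)norm `‖g‖_{q,s}` of `L_q(s)`, `s ⊆ ℝ`, for functions with values in `[0, ∞]`. -/
def normOn (q : ℝ≥0∞) (s : Set ℝ) (g : ℝ → ℝ≥0∞) : ℝ≥0∞ :=
  eLpNorm g q (volume.restrict s)

/-- The real number `1 / q`, for `q ∈ (0, ∞]`, with `1 / ∞ = 0`. -/
def rinv (q : ℝ≥0∞) : ℝ := (q⁻¹).toReal

/-- The expression `‖ t^{-1/r} b(t) ‖ u^{σ - 1/q} a(u) g(u) ‖_{q,(0,t)} ‖_{r,(0,∞)}`. -/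
def leftNorm (σ : ℝ) (r : ℝ≥0∞) (b : ℝ → ℝ) (q : ℝ≥0∞) (a : ℝ → ℝ) (g : ℝ → ℝ≥0∞) : ℝ≥0∞ :=
  normOn r (Ioi 0) fun t => ENNReal.ofReal (t ^ (-rinv r) * b t) *
    normOn q (Ioo 0 t) fun u => ENNReal.ofReal (u ^ (σ - rinv q) * a u) * g u

/-! ### Function spaces as subsets of an ambient space with a quasi-norm -/

/-- A subset of an ambient vector space `V` together with its quasi-norm. -/
structure FnSpace (V : Type*) where
  /-- the elements of the space -/
  carrier : Set V
  /-- the quasi-norm, `[0, ∞]`-valued on `V` -/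
  qnorm : V → ℝ≥0∞

/-- The space of all `f` with finite quasi-norm. -/
def FnSpace.ofNorm {V : Type*} (N : V → ℝ≥0∞) : FnSpace V := ⟨{f | N f < ∞}, N⟩

/-- `X ⊂ Y`: inclusion with continuous (that is, bounded) inclusion map. -/
def FnSpace.Embeds {V : Type*} (X Y : FnSpace V) : Prop :=
  X.carrier ⊆ Y.carrier ∧ ∃ C : ℝ≥0, ∀ f ∈ X.carrier, Y.qnorm f ≤ C * X.qnorm f

/-- `X = Y`: the spaces coincide and their quasi-norms are equivalent. -/
def FnSpace.Same {V : Type*} (X Y : FnSpace V) : Prop := X.Embeds Y ∧ Y.Embeds X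

/-! ### The `K`-functional and the `𝓛` interpolation method -/

/-- Membership in `A₀ + A₁`. -/
def IsSum {V : Type*} [AddCommGroup V] (A₀ A₁ : FnSpace V) (f : V) : Prop :=
  ∃ f₀ ∈ A₀.carrier, ∃ f₁ ∈ A₁.carrier, f = f₀ + f₁

/-- Peetre's functional
`K(t, f) = inf { ‖f₀‖_{A₀} + t ‖f₁‖_{A₁} : f = f₀ + f₁, f₀ ∈ A₀, f₁ ∈ A₁ }`. -/
def peetreK {V : Type*} [AddCommGroup V] (A₀ A₁ : FnSpace V) (t : ℝ) (f : V) : ℝ≥0∞ :=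
  ⨅ (f₀ ∈ A₀.carrier) (f₁ ∈ A₁.carrier) (_ : f = f₀ + f₁),
    A₀.qnorm f₀ + ENNReal.ofReal t * A₁.qnorm f₁

/-- `(A₀, A₁)^𝓛_{θ,r,b,q,a}`: all `f ∈ A₀ + A₁` for which
`‖ t^{-1/r} b(t) ‖ u^{-θ - 1/q} a(u) K(u, f) ‖_{q,(0,t)} ‖_{r,(0,∞)}` is finite. -/
def interpL {V : Type*} [AddCommGroup V] (A₀ A₁ : FnSpace V) (θ : ℝ)
    (r : ℝ≥0∞) (b : ℝ → ℝ) (q : ℝ≥0∞) (a : ℝ → ℝ) : FnSpace V where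
  carrier := {f | IsSum A₀ A₁ f ∧ leftNorm (-θ) r b q a (fun u => peetreK A₀ A₁ u f) < ∞}
  qnorm f := leftNorm (-θ) r b q a fun u => peetreK A₀ A₁ u f

/-! ### Rearrangement-invariant spaces over `(Ω, μ)` -/

/-- `μ` has no atoms: every measurable set of positive measure has a measurable subset of positive,
strictly smaller measure. (Stronger than Mathlib's `NoAtoms`, which only concerns points; it is
used for σ-finite measures, where it is the usual notion.) -/
def NonAtomic {Ω : Type*} [MeasurableSpace Ω] (μ : Measure Ω) : Prop :=
  ∀ A, MeasurableSet A → 0 < μ A → ∃ B ⊆ A, MeasurableSet B ∧ 0 < μ B ∧ μ B < μ A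

section spaces

variable {Ω : Type*} [MeasurableSpace Ω] {μ : Measure Ω} {𝕜 : Type*} [RCLike 𝕜]

/-- The non-increasing rearrangement `f*(t) = inf { s ≥ 0 : μ{|f| > s} ≤ t }`, `t > 0`. -/
def rearr (f : Ω →ₘ[μ] 𝕜) (t : ℝ) : ℝ≥0∞ :=
  sInf {s : ℝ≥0∞ | μ {x | s < ‖f x‖ₑ} ≤ ENNReal.ofReal t}

variable (μ 𝕜)

/-- The Lebesgue space `L_p`, `0 < p ≤ ∞`. -/
def Lebesgue (p : ℝ≥0∞) : FnSpace (Ω →ₘ[μ] 𝕜) := .ofNorm fun f => eLpNorm f p μ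

/-- The Lorentz space `L_{p,∞}` (weak `L_p`), with quasi-norm `sup_{t > 0} t^{1/p} f*(t)`. -/
def WeakLebesgue (p : ℝ≥0∞) : FnSpace (Ω →ₘ[μ] 𝕜) :=
  .ofNorm fun f => ⨆ t ∈ Ioi (0 : ℝ), ENNReal.ofReal (t ^ rinv p) * rearr f t

/-- The `𝓛` Lorentz–Karamata space `L^𝓛_{p,r,b,q,a}`, with quasi-norm
`‖ t^{-1/r} b(t) ‖ u^{1/p - 1/q} a(u) f*(u) ‖_{q,(0,t)} ‖_{r,(0,∞)}`. -/
def LKL (p r : ℝ≥0∞) (b : ℝ → ℝ) (q : ℝ≥0∞) (a : ℝ → ℝ) : FnSpace (Ω →ₘ[μ] 𝕜) :=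
  .ofNorm fun f => leftNorm (rinv p) r b q a (rearr f)

/-- The small Lorentz–Karamata space `L^{(p,q,r}_b`, with quasi-norm
`‖ t^{-1/r} b(t) ‖ u^{1/p - 1/q} f*(u) ‖_{q,(0,t)} ‖_{r,(0,∞)}`. -/
def SmallLK (p q r : ℝ≥0∞) (b : ℝ → ℝ) : FnSpace (Ω →ₘ[μ] 𝕜) :=
  .ofNorm fun f => normOn r (Ioi 0) fun t => ENNReal.ofReal (t ^ (-rinv r) * b t) *
    normOn q (Ioo 0 t) fun u => ENNReal.ofReal (u ^ (rinv p - rinv q)) * rearr f u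

end spaces

end

end LorentzKaramata

namespace LorentzKaramata

/-! ### Integrals via distribution functions -/

/-! Write `G(u) = u f*(u^κ)` and `H(u) = (∫₀^{u^κ} (f*)^κ)^{1/κ}` (`powerMean`). Everything rests on
the pointwise chain `G(u) ≤ K(u, f; L_{κ,∞}, L_∞) ≤ K(u, f; L_κ, L_∞) ≤ 2 H(u)`. The left inequality
holds because `f*` grows by at most `‖f₁‖_∞` when `f₁` is added (`mul_rearr_le_peetreK`). The middle
one is Chebyshev's inequality. The right one comes from splitting `f` at height `f*(u^κ)`
(`peetreK_le_powerMean`).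

The chain closes up to constants once the weighted norm of `H` on `(0, T)` is bounded by that of
`G`, uniformly in `T` (`SlowlyVarying.exists_normOn_powerMean_le`). This Hardy inequality is where
`θ > 0` enters. It has to cover all `q > 0`, so the triangle inequality is avoided: monotonicity of
`f*` gives `H(u) ≤ C sup_n 2^{δn} G(u / 2^{n+1})`, each dilation by `2^{n+1}` gains a factor
`2^{-(n+1)θ/2}` in the norm, and for small `δ` the terms decay geometrically.

The outer norm only sees an inner estimate valid for every `t`, so `r` and `b` play no role in the
inequalities. The substitution `u = v^κ` (`leftNorm_rpow`) turns the iterated norm of `G` into the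
Lorentz–Karamata norm. -/

theorem volume_setOf_ofReal_lt (m : ℝ≥0∞) :
    volume {s : ℝ | s ∈ Ioi 0 ∧ ENNReal.ofReal s < m} = m := by
  induction m using ENNReal.recTopCoe with
  | top =>
    have : {s : ℝ | s ∈ Ioi 0 ∧ ENNReal.ofReal s < ⊤} = Ioi 0 := by
      ext s; simp
    rw [this]; simp
  | coe m =>
    have : {s : ℝ | s ∈ Ioi 0 ∧ ENNReal.ofReal s < m} = Ioo 0 (m : ℝ) := by
      ext s
      simp only [mem_ofPred_eq, mem_Ioi, mem_Ioo]
      refine and_congr_right fun hs => ?_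
      rw [← ENNReal.ofReal_coe_nnreal, ENNReal.ofReal_lt_ofReal_iff_of_nonneg hs.le]
    rw [this]; simp

/-- Tonelli on the region below the graph of `g`. The levels are real while `g` may take the value
`∞`, so the formula applies to the `[0, ∞]`-valued rearrangement as well as to functions on `Ω`. -/
theorem lintegral_eq_lintegral_measure_ofReal_lt {α : Type*} [MeasurableSpace α] (μ : Measure α)
    [SFinite μ] {g : α → ℝ≥0∞} (hg : Measurable g) :
    ∫⁻ x, g x ∂μ = ∫⁻ s in Ioi (0 : ℝ), μ {x | ENNReal.ofReal s < g x} := by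
  have hm : MeasurableSet {z : α × ℝ | ENNReal.ofReal z.2 < g z.1} :=
    measurableSet_lt (ENNReal.measurable_ofReal.comp measurable_snd) (hg.comp measurable_fst)
  calc ∫⁻ x, g x ∂μ
      = ∫⁻ x, (∫⁻ s in Ioi (0 : ℝ),
          {z : α × ℝ | ENNReal.ofReal z.2 < g z.1}.indicator 1 (x, s)) ∂μ := by
        refine lintegral_congr fun x => ?_
        have hx : MeasurableSet {s : ℝ | ENNReal.ofReal s < g x} :=
          measurableSet_lt ENNReal.measurable_ofReal measurable_const
        have : (fun s : ℝ => {z : α × ℝ | ENNReal.ofReal z.2 < g z.1}.indicator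
            (1 : α × ℝ → ℝ≥0∞) (x, s)) = {s : ℝ | ENNReal.ofReal s < g x}.indicator 1 := by
          ext s; simp [indicator]
        rw [this, lintegral_indicator_one hx, Measure.restrict_apply hx]
        conv_lhs => rw [← volume_setOf_ofReal_lt (g x)]
        congr 1; ext s; simp [and_comm]
    _ = ∫⁻ s in Ioi (0 : ℝ), (∫⁻ x,
          {z : α × ℝ | ENNReal.ofReal z.2 < g z.1}.indicator 1 (x, s) ∂μ) :=
        lintegral_lintegral_swap (measurable_one.indicator hm).aemeasurable
    _ = _ := by
        refine lintegral_congr fun s => ?_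
        have hs : MeasurableSet {x | ENNReal.ofReal s < g x} :=
          measurableSet_lt measurable_const hg
        rw [← lintegral_indicator_one hs]
        refine lintegral_congr fun x => ?_
        simp [indicator]

theorem measure_setOf_lt_anti {α : Type*} [MeasurableSpace α] (μ : Measure α) (g : α → ℝ≥0∞) :
    Antitone fun s => μ {x | s < g x} :=
  fun _ _ h => measure_mono fun _ hx => mem_ofPred_eq ▸ lt_of_le_of_lt h hx

/-! ### The non-increasing rearrangement -/

section rearr

variable {Ω : Type*} [MeasurableSpace Ω] {μ : Measure Ω} {𝕜 : Type*} [RCLike 𝕜]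

theorem rearr_antitone (f : Ω →ₘ[μ] 𝕜) : Antitone (rearr f) := fun _ _ h =>
  sInf_le_sInf fun _ hs => le_trans hs (ENNReal.ofReal_le_ofReal h)

/-- The infimum defining `f*(t)` is attained: along levels decreasing to it, the superlevel sets
increase to the superlevel set of the limit, and measures are continuous along increasing unions. -/
theorem measure_rearr_lt_le (f : Ω →ₘ[μ] 𝕜) (t : ℝ) :
    μ {x | rearr f t < ‖f x‖ₑ} ≤ ENNReal.ofReal t := by
  have hne : {s : ℝ≥0∞ | μ {x | s < ‖f x‖ₑ} ≤ ENNReal.ofReal t}.Nonempty := ⟨∞, by simp⟩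
  obtain ⟨u, hu, hlim, hmem⟩ := exists_seq_tendsto_sInf hne (OrderBot.bddBelow _)
  have hset : {x | rearr f t < ‖f x‖ₑ} ⊆ ⋃ n, {x | u n < ‖f x‖ₑ} := fun x hx =>
    mem_iUnion.2 (((tendsto_order.1 hlim).2 _ hx).exists)
  refine (measure_mono hset).trans ?_
  rw [Monotone.measure_iUnion (s := fun n => {x | u n < ‖f x‖ₑ})
    fun i j hij x hx => lt_of_le_of_lt (hu hij) hx]
  exact iSup_le hmem

theorem lt_rearr {f : Ω →ₘ[μ] 𝕜} {t : ℝ} {s : ℝ≥0∞}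
    (h : ENNReal.ofReal t < μ {x | s < ‖f x‖ₑ}) : s < rearr f t := by
  by_contra! hs
  exact absurd ((measure_setOf_lt_anti μ (‖f ·‖ₑ) hs).trans (measure_rearr_lt_le f t)) (not_le.2 h)

theorem rearr_le {f : Ω →ₘ[μ] 𝕜} {t : ℝ} {s : ℝ≥0∞}
    (h : μ {x | s < ‖f x‖ₑ} ≤ ENNReal.ofReal t) : rearr f t ≤ s := sInf_le h

/-- Almost everywhere off `{|f| > f*(t)}`, a set of measure at most `t`, one has `|f + g| ≤ f*(t) +
‖g‖_∞`. -/
theorem rearr_add_le (f g : Ω →ₘ[μ] 𝕜) (t : ℝ) :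
    rearr (f + g) t ≤ rearr f t + eLpNorm g ∞ μ := by
  refine rearr_le (le_trans (measure_mono_ae ?_) (measure_rearr_lt_le f t))
  filter_upwards [AEEqFun.coeFn_add f g, ae_le_eLpNormEssSup (f := g) (μ := μ)] with x hx hg h
  change _ < _ at h
  change _ < _
  by_contra! hc
  refine absurd h (not_lt.2 ?_)
  rw [hx, eLpNorm_exponent_top]
  exact (enorm_add_le _ _).trans (add_le_add hc hg)

/-- Chebyshev's inequality at the level `‖f‖_κ / t^{1/κ}`. -/
theorem rpow_mul_rearr_le_eLpNorm {κ : ℝ} (hκ : 0 < κ) (f : Ω →ₘ[μ] 𝕜) {t : ℝ} (ht : 0 < t) :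
    ENNReal.ofReal (t ^ (1 / κ)) * rearr f t ≤ eLpNorm f (ENNReal.ofReal κ) μ := by
  set N := eLpNorm f (ENNReal.ofReal κ) μ with hN
  have hp0 : ENNReal.ofReal κ ≠ 0 := by simpa using hκ
  have htk : 0 < t ^ (1 / κ) := Real.rpow_pos_of_pos ht _
  have hc0 : ENNReal.ofReal (t ^ (1 / κ)) ≠ 0 := by simpa using htk
  have hct : ENNReal.ofReal (t ^ (1 / κ)) ≠ ∞ := ENNReal.ofReal_ne_top
  rcases eq_or_ne N ∞ with hNt | hNt
  · rw [hNt]; exact le_top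
  rw [mul_comm, ← ENNReal.le_div_iff_mul_le (Or.inl hc0) (Or.inl hct)]
  refine rearr_le ?_
  -- For `N = 0` the level is `0` and Chebyshev only says `0 ≤ 0`, so this case is settled by `f =
  -- 0` almost everywhere.
  rcases eq_or_ne N 0 with h0 | h0
  · have hf0 : (f : Ω → 𝕜) =ᵐ[μ] 0 :=
      (eLpNorm_eq_zero_iff f.aestronglyMeasurable hp0).1 (hN ▸ h0)
    have : μ {x | N / ENNReal.ofReal (t ^ (1 / κ)) < ‖f x‖ₑ} = 0 := by
      rw [h0]
      refine measure_mono_null (fun x hx => ?_) hf0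
      intro h
      simp only [ENNReal.zero_div, mem_ofPred_eq] at hx
      rw [h] at hx
      simp at hx
    rw [this]; exact zero_le
  have key := mul_meas_ge_le_pow_eLpNorm' μ hp0 ENNReal.ofReal_ne_top f.aestronglyMeasurable
    (N / ENNReal.ofReal (t ^ (1 / κ)))
  rw [ENNReal.toReal_ofReal hκ.le, ← hN, ENNReal.div_rpow_of_nonneg _ _ hκ.le,
    ENNReal.ofReal_rpow_of_pos htk, ← Real.rpow_mul ht.le, one_div_mul_cancel hκ.ne',
    Real.rpow_one] at key
  have hNκ0 : N ^ κ ≠ 0 := by simp [ENNReal.rpow_eq_zero_iff, h0, hNt]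
  have hNκt : N ^ κ ≠ ∞ := ENNReal.rpow_ne_top_of_nonneg hκ.le hNt
  have ht0 : ENNReal.ofReal t ≠ 0 := by simpa using ht
  refine (measure_mono (t := {x | N / ENNReal.ofReal (t ^ (1 / κ)) ≤ ‖f x‖ₑ})
    fun x hx => (mem_ofPred_eq ▸ hx : _ < _).le).trans ?_
  set m := μ {x | N / ENNReal.ofReal (t ^ (1 / κ)) ≤ ‖f x‖ₑ}
  rw [ENNReal.div_eq_inv_mul, mul_assoc,
    ENNReal.inv_mul_le_iff ht0 ENNReal.ofReal_ne_top, mul_comm (ENNReal.ofReal t)] at key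
  exact (ENNReal.mul_le_mul_iff_right hNκ0 hNκt).1 key

/-- The truncation estimate behind the upper bound for the `K`-functional. -/
theorem lintegral_rpow_above_rearr_le [SigmaFinite μ] {κ : ℝ} (hκ : 0 < κ) (f : Ω →ₘ[μ] 𝕜)
    (U : ℝ) :
    ∫⁻ x, ‖{x | rearr f U < ‖f x‖ₑ}.indicator f x‖ₑ ^ κ ∂μ ≤
      ∫⁻ v in Ioo 0 U, rearr f v ^ κ := by
  have hf : Measurable (f : Ω → 𝕜) := f.measurable
  have hS : MeasurableSet {x | rearr f U < ‖f x‖ₑ} := measurableSet_lt measurable_const hf.enorm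
  rw [lintegral_eq_lintegral_measure_ofReal_lt μ ((hf.indicator hS).enorm.pow_const κ),
    lintegral_eq_lintegral_measure_ofReal_lt _ ((rearr_antitone f).measurable.pow_const κ)]
  refine lintegral_mono fun s => ?_
  dsimp only
  have hiff : ∀ y : ℝ≥0∞, ENNReal.ofReal s < y ^ κ ↔ ENNReal.ofReal s ^ κ⁻¹ < y := fun y => by
    rw [ENNReal.rpow_inv_lt_iff hκ]
  simp only [hiff]
  set σ := ENNReal.ofReal s ^ κ⁻¹
  rw [Measure.restrict_apply (measurableSet_lt measurable_const (rearr_antitone f).measurable)]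
  -- The two distribution functions are compared level by level through `m`: it dominates the
  -- measure on the left, and every `v < m` satisfies both `f*(v) > σ` and, because `m ≤ U`, `v <
  -- U`.
  set m := μ {x | max σ (rearr f U) < ‖f x‖ₑ}
  have h1 : μ {x | σ < ‖{x | rearr f U < ‖f x‖ₑ}.indicator f x‖ₑ} ≤ m := by
    refine measure_mono fun x hx => ?_
    by_cases hxS : x ∈ {x | rearr f U < ‖f x‖ₑ}
    · rw [mem_ofPred_eq, indicator_of_mem hxS] at hx
      exact max_lt hx hxS
    · rw [mem_ofPred_eq, indicator_of_notMem hxS] at hx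
      simp at hx
  have hmU : m ≤ ENNReal.ofReal U :=
    (measure_setOf_lt_anti μ (‖f ·‖ₑ) (le_max_right _ _)).trans (measure_rearr_lt_le f U)
  refine h1.trans ?_
  rw [← volume_setOf_ofReal_lt m]
  refine measure_mono fun v hv => ⟨?_, hv.1, ?_⟩
  · exact lt_of_le_of_lt (le_max_left _ _) (lt_rearr hv.2)
  · exact (ENNReal.ofReal_lt_ofReal_iff_of_nonneg (le_of_lt hv.1)).1 (lt_of_lt_of_le hv.2 hmU)

/-! ### Bounds for the `K`-functional of the couples with `L_∞`. -/

/-- `H(u) = (∫₀^{u^κ} h^κ)^{1/κ}`. -/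
noncomputable def powerMean (κ : ℝ) (h : ℝ → ℝ≥0∞) (u : ℝ) : ℝ≥0∞ :=
  (∫⁻ v in Ioo 0 (u ^ κ), h v ^ κ) ^ κ⁻¹

theorem mul_le_powerMean {κ : ℝ} (hκ : 0 < κ) {h : ℝ → ℝ≥0∞} (hh : Antitone h) {u : ℝ}
    (hu : 0 < u) : ENNReal.ofReal u * h (u ^ κ) ≤ powerMean κ h u := by
  have huκ := Real.rpow_pos_of_pos hu κ
  rw [powerMean, ENNReal.le_rpow_inv_iff hκ, ENNReal.mul_rpow_of_nonneg _ _ hκ.le,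
    ENNReal.ofReal_rpow_of_pos hu]
  calc ENNReal.ofReal (u ^ κ) * h (u ^ κ) ^ κ
      = ∫⁻ _ in Ioo 0 (u ^ κ), h (u ^ κ) ^ κ := by simp [mul_comm]
    _ ≤ _ := setLIntegral_mono' measurableSet_Ioo fun v hv =>
        ENNReal.rpow_le_rpow (hh hv.2.le) hκ.le

/-- `f` is cut by the set where `|f| > f*(u^κ)`. The part on this set is controlled by the
truncation estimate; the rest is bounded by `f*(u^κ)`, and `u f*(u^κ)` is at most the power mean
because `f*` is non-increasing. Finiteness at one `u` is enough to place `f` in `L_κ + L_∞`. -/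
theorem exists_decomposition [SigmaFinite μ] {κ : ℝ} (hκ : 0 < κ) (f : Ω →ₘ[μ] 𝕜) {u : ℝ}
    (hu : 0 < u) (hfin : powerMean κ (rearr f) u < ∞) :
    ∃ f₀ ∈ (Lebesgue μ 𝕜 (ENNReal.ofReal κ)).carrier, ∃ f₁ ∈ (Lebesgue μ 𝕜 ∞).carrier,
      f = f₀ + f₁ ∧ eLpNorm f₀ (ENNReal.ofReal κ) μ ≤ powerMean κ (rearr f) u ∧
      ENNReal.ofReal u * eLpNorm f₁ ∞ μ ≤ powerMean κ (rearr f) u := by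
  have hf : Measurable (f : Ω → 𝕜) := f.measurable
  set S := {x | rearr f (u ^ κ) < ‖f x‖ₑ} with hSdef
  have hS : MeasurableSet S := measurableSet_lt measurable_const hf.enorm
  let f₀ : Ω →ₘ[μ] 𝕜 := AEEqFun.mk (S.indicator f) (f.aestronglyMeasurable.indicator hS)
  let f₁ : Ω →ₘ[μ] 𝕜 := AEEqFun.mk (Sᶜ.indicator f) (f.aestronglyMeasurable.indicator hS.compl)
  have h0 : eLpNorm f₀ (ENNReal.ofReal κ) μ ≤ powerMean κ (rearr f) u := by
    rw [eLpNorm_congr_ae (AEEqFun.coeFn_mk _ _), eLpNorm_eq_lintegral_rpow_enorm_toReal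
      (by simpa using hκ) ENNReal.ofReal_ne_top, ENNReal.toReal_ofReal hκ.le, one_div]
    exact ENNReal.rpow_le_rpow (lintegral_rpow_above_rearr_le hκ f _) (inv_nonneg.2 hκ.le)
  have h1' : eLpNorm f₁ ∞ μ ≤ rearr f (u ^ κ) := by
    rw [eLpNorm_congr_ae (AEEqFun.coeFn_mk _ _), eLpNorm_exponent_top]
    refine eLpNormEssSup_le_of_ae_enorm_bound (Filter.Eventually.of_forall fun x => ?_)
    by_cases hx : x ∈ S
    · simp [hx]
    · rw [indicator_of_mem (show x ∈ Sᶜ from hx)]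
      exact not_lt.1 hx
  have h1 : ENNReal.ofReal u * eLpNorm f₁ ∞ μ ≤ powerMean κ (rearr f) u :=
    (by gcongr : _ ≤ ENNReal.ofReal u * rearr f (u ^ κ)).trans
      (mul_le_powerMean hκ (rearr_antitone f) hu)
  refine ⟨f₀, h0.trans_lt hfin, f₁, ?_, ?_, h0, h1⟩
  · change eLpNorm f₁ ∞ μ < ∞
    by_contra! hc
    rw [top_le_iff.1 hc, ENNReal.mul_top (by simpa using hu)] at h1
    exact absurd hfin (not_lt.2 h1)
  · refine AEEqFun.ext ?_
    filter_upwards [AEEqFun.coeFn_add f₀ f₁,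
      AEEqFun.coeFn_mk (S.indicator f) (f.aestronglyMeasurable.indicator hS),
      AEEqFun.coeFn_mk (Sᶜ.indicator f) (f.aestronglyMeasurable.indicator hS.compl)]
      with x hx hx0 hx1
    rw [hx, Pi.add_apply, hx0, hx1]
    exact (congrFun (indicator_self_add_compl S f) x).symm

theorem peetreK_le_powerMean [SigmaFinite μ] {κ : ℝ} (hκ : 0 < κ) (f : Ω →ₘ[μ] 𝕜) {u : ℝ}
    (hu : 0 < u) :
    peetreK (Lebesgue μ 𝕜 (ENNReal.ofReal κ)) (Lebesgue μ 𝕜 ∞) u f ≤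
      2 * powerMean κ (rearr f) u := by
  rcases eq_or_ne (powerMean κ (rearr f) u) ∞ with h | h
  · rw [h]; simp
  obtain ⟨f₀, hf₀, f₁, hf₁, hf, h0, h1⟩ := exists_decomposition hκ f hu h.lt_top
  rw [two_mul]
  exact (iInf₂_le_of_le f₀ hf₀ (iInf₂_le_of_le f₁ hf₁ (iInf_le _ hf))).trans (add_le_add h0 h1)

theorem rinv_ofReal {κ : ℝ} (hκ : 0 < κ) : rinv (ENNReal.ofReal κ) = 1 / κ := by
  rw [rinv, ENNReal.toReal_inv, ENNReal.toReal_ofReal hκ.le, one_div]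

theorem weakQnorm_le_eLpNorm {κ : ℝ} (hκ : 0 < κ) (f : Ω →ₘ[μ] 𝕜) :
    (WeakLebesgue μ 𝕜 (ENNReal.ofReal κ)).qnorm f ≤
      (Lebesgue μ 𝕜 (ENNReal.ofReal κ)).qnorm f := by
  refine iSup₂_le fun t ht => ?_
  rw [rinv_ofReal hκ]
  exact rpow_mul_rearr_le_eLpNorm hκ f ht

theorem lebesgue_subset_weakLebesgue {κ : ℝ} (hκ : 0 < κ) :
    (Lebesgue μ 𝕜 (ENNReal.ofReal κ)).carrier ⊆ (WeakLebesgue μ 𝕜 (ENNReal.ofReal κ)).carrier :=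
  fun f hf => (weakQnorm_le_eLpNorm hκ f).trans_lt hf

theorem peetreK_weak_le {κ : ℝ} (hκ : 0 < κ) (f : Ω →ₘ[μ] 𝕜) (u : ℝ) :
    peetreK (WeakLebesgue μ 𝕜 (ENNReal.ofReal κ)) (Lebesgue μ 𝕜 ∞) u f ≤
      peetreK (Lebesgue μ 𝕜 (ENNReal.ofReal κ)) (Lebesgue μ 𝕜 ∞) u f := by
  refine le_iInf₂ fun f₀ hf₀ => le_iInf₂ fun f₁ hf₁ => le_iInf fun hf => ?_
  refine (iInf₂_le_of_le f₀ (lebesgue_subset_weakLebesgue hκ hf₀)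
    (iInf₂_le_of_le f₁ hf₁ (iInf_le _ hf))).trans ?_
  gcongr
  exact weakQnorm_le_eLpNorm hκ f₀

/-- The weak quasi-norm is tested at the single point `t = u^κ`, where `t^{1/κ} = u`. -/
theorem mul_rearr_le_peetreK {κ : ℝ} (hκ : 0 < κ) (f : Ω →ₘ[μ] 𝕜) {u : ℝ} (hu : 0 < u) :
    ENNReal.ofReal u * rearr f (u ^ κ) ≤
      peetreK (WeakLebesgue μ 𝕜 (ENNReal.ofReal κ)) (Lebesgue μ 𝕜 ∞) u f := by
  refine le_iInf₂ fun f₀ hf₀ => le_iInf₂ fun f₁ hf₁ => le_iInf fun hf => ?_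
  have hw : ENNReal.ofReal u * rearr f₀ (u ^ κ) ≤
      (WeakLebesgue μ 𝕜 (ENNReal.ofReal κ)).qnorm f₀ := by
    refine le_trans (le_of_eq ?_)
      (le_iSup₂ (f := fun (t : ℝ) (_ : t ∈ Ioi (0 : ℝ)) =>
        ENNReal.ofReal (t ^ rinv (ENNReal.ofReal κ)) * rearr f₀ t) (u ^ κ)
        (Real.rpow_pos_of_pos hu κ))
    rw [rinv_ofReal hκ, ← Real.rpow_mul hu.le, mul_one_div_cancel hκ.ne', Real.rpow_one]
  calc ENNReal.ofReal u * rearr f (u ^ κ)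
      ≤ ENNReal.ofReal u * (rearr f₀ (u ^ κ) + eLpNorm f₁ ∞ μ) := by
        gcongr; rw [hf]; exact rearr_add_le f₀ f₁ _
    _ ≤ _ := by rw [mul_add]; exact add_le_add hw le_rfl

end rearr

/-! ### Monotonicity and change of variables for `normOn` -/

theorem normOn_le_mul {q : ℝ≥0∞} {s : Set ℝ} (hs : MeasurableSet s) {f g : ℝ → ℝ≥0∞} {C : ℝ≥0}
    (h : ∀ u ∈ s, f u ≤ C * g u) : normOn q s f ≤ C * normOn q s g :=
  eLpNorm_le_nnreal_smul_eLpNorm_of_ae_le_mul'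
    ((ae_restrict_iff' hs).2 (Filter.Eventually.of_forall h)) q

theorem normOn_mono {q : ℝ≥0∞} {s : Set ℝ} (hs : MeasurableSet s) {f g : ℝ → ℝ≥0∞}
    (h : ∀ u ∈ s, f u ≤ g u) : normOn q s f ≤ normOn q s g :=
  eLpNorm_mono_enorm_ae ((ae_restrict_iff' hs).2 (Filter.Eventually.of_forall h))

theorem normOn_congr {q : ℝ≥0∞} {s : Set ℝ} (hs : MeasurableSet s) {f g : ℝ → ℝ≥0∞}
    (h : ∀ u ∈ s, f u = g u) : normOn q s f = normOn q s g :=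
  le_antisymm (normOn_mono hs fun u hu => (h u hu).le) (normOn_mono hs fun u hu => (h u hu).ge)

theorem normOn_mono_set {q : ℝ≥0∞} {s t : Set ℝ} (h : s ⊆ t) (f : ℝ → ℝ≥0∞) :
    normOn q s f ≤ normOn q t f :=
  eLpNorm_mono_measure _ (Measure.restrict_mono h le_rfl)

theorem normOn_const_mul {q : ℝ≥0∞} {s : Set ℝ} (hs : MeasurableSet s) {f : ℝ → ℝ≥0∞} {C : ℝ≥0}
    (hC : C ≠ 0) : normOn q s (fun u => C * f u) = C * normOn q s f := by
  refine le_antisymm (normOn_le_mul hs fun u _ => le_rfl) ?_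
  have hC' : (C : ℝ≥0∞) ≠ 0 := by simpa using hC
  have h : normOn q s f ≤ (C⁻¹ : ℝ≥0) * normOn q s (fun u => C * f u) := by
    refine normOn_le_mul hs fun u _ => ?_
    rw [← mul_assoc, ← ENNReal.coe_mul, inv_mul_cancel₀ hC, ENNReal.coe_one, one_mul]
  calc (C : ℝ≥0∞) * normOn q s f ≤ C * ((C⁻¹ : ℝ≥0) * normOn q s (fun u => C * f u)) := by gcongr
    _ = _ := by rw [← mul_assoc, ← ENNReal.coe_mul, mul_inv_cancel₀ hC, ENNReal.coe_one, one_mul]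

theorem normOn_eq_lintegral {q : ℝ≥0∞} (hq0 : q ≠ 0) (hqt : q ≠ ∞) (s : Set ℝ) (f : ℝ → ℝ≥0∞) :
    normOn q s f = (∫⁻ u in s, f u ^ q.toReal) ^ rinv q := by
  rw [normOn, eLpNorm_eq_lintegral_rpow_enorm_toReal hq0 hqt, rinv, ENNReal.toReal_inv, one_div]
  simp

/-- A map differentiable on a set sends null subsets of it to null sets, so an essential bound on `F
∘ φ` passes to `F` on the image. -/
theorem essSup_image_le {φ φ' : ℝ → ℝ} {s : Set ℝ} (hs : MeasurableSet s)
    (hφ : ∀ v ∈ s, HasDerivWithinAt φ (φ' v) s v) (hm : MeasurableSet (φ '' s))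
    (F : ℝ → ℝ≥0∞) : normOn ∞ (φ '' s) F ≤ normOn ∞ s (F ∘ φ) := by
  rw [normOn, normOn, eLpNorm_exponent_top, eLpNorm_exponent_top]
  refine eLpNormEssSup_le_of_ae_enorm_bound ?_
  have h0 := ae_le_eLpNormEssSup (f := F ∘ φ) (μ := volume.restrict s)
  set A := eLpNormEssSup (F ∘ φ) (volume.restrict s)
  rw [ae_restrict_iff' hs, ae_iff] at h0
  rw [ae_restrict_iff' hm, ae_iff]
  refine measure_mono_null ?_ (addHaar_image_eq_zero_of_differentiableOn_of_addHaar_eq_zero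
    (s := {v | ¬(v ∈ s → ‖(F ∘ φ) v‖ₑ ≤ A)}) volume (f := φ) ?_ h0)
  · intro u hu
    rw [mem_ofPred_eq, Classical.not_imp] at hu
    obtain ⟨⟨v, hv, rfl⟩, hu⟩ := hu
    exact ⟨v, fun h => hu (h hv), rfl⟩
  · intro v hv
    rw [mem_ofPred_eq, Classical.not_imp] at hv
    refine ((hφ v hv.1).differentiableWithinAt).mono fun w hw => ?_
    rw [mem_ofPred_eq, Classical.not_imp] at hw
    exact hw.1

theorem hasDerivWithinAt_mul_rpow (c k : ℝ) {v : ℝ} (hv : 0 < v) (s : Set ℝ) :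
    HasDerivWithinAt (fun v : ℝ => c * v ^ k) (c * (k * v ^ (k - 1))) s v :=
  ((Real.hasDerivAt_rpow_const (Or.inl hv.ne')).const_mul c).hasDerivWithinAt

theorem mul_rpow_leftInv {c k v : ℝ} (hc : 0 < c) (hk : 0 < k) (hv : 0 < v) :
    (c⁻¹) ^ k⁻¹ * (c * v ^ k) ^ k⁻¹ = v := by
  rw [← Real.mul_rpow (by positivity) (by positivity), ← mul_assoc, inv_mul_cancel₀ hc.ne',
    one_mul, Real.rpow_rpow_inv hv.le hk.ne']

theorem injOn_mul_rpow {c k : ℝ} (hc : 0 < c) (hk : 0 < k) {s : Set ℝ} (hs : s ⊆ Ioi 0) :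
    InjOn (fun v : ℝ => c * v ^ k) s := fun v hv w hw h => by
  rw [← mul_rpow_leftInv hc hk (hs hv), ← mul_rpow_leftInv hc hk (hs hw)]
  simp only at h
  rw [h]

/-- Change of variables `u = c v ^ k` with the scale-invariant weight `u ^ (-1 / q)`. -/
theorem normOn_image_mul_rpow {q : ℝ≥0∞} {c k : ℝ} (hc : 0 < c) (hk : 0 < k) {s : Set ℝ}
    (hs : MeasurableSet s) (hs0 : s ⊆ Ioi 0) (F : ℝ → ℝ≥0∞) :
    normOn q ((fun v : ℝ => c * v ^ k) '' s) (fun u => ENNReal.ofReal (u ^ (-rinv q)) * F u) =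
      ENNReal.ofReal (k ^ rinv q) *
        normOn q s (fun v => ENNReal.ofReal (v ^ (-rinv q)) * F (c * v ^ k)) := by
  have hd : ∀ v ∈ s, HasDerivWithinAt (fun v : ℝ => c * v ^ k) (c * (k * v ^ (k - 1))) s v :=
    fun v hv => hasDerivWithinAt_mul_rpow c k (hs0 hv) s
  have hinj := injOn_mul_rpow hc hk hs0
  have him : MeasurableSet ((fun v : ℝ => c * v ^ k) '' s) :=
    hs.image_of_measurable_injOn (by fun_prop) hinj
  rcases eq_or_ne q 0 with rfl | hq0
  · simp [normOn]
  rcases eq_or_ne q ∞ with rfl | hqt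
  · simp only [rinv, ENNReal.inv_top, ENNReal.toReal_zero, neg_zero, Real.rpow_zero,
      ENNReal.ofReal_one, one_mul]
    refine le_antisymm (essSup_image_le hs hd him F) ?_
    -- The reverse inequality is `essSup_image_le` for the inverse substitution.
    set ψ : ℝ → ℝ := fun u => (c⁻¹) ^ k⁻¹ * u ^ k⁻¹ with hψ
    have hψs : ψ '' ((fun v : ℝ => c * v ^ k) '' s) = s := by
      rw [image_image]
      refine (image_congr fun v hv => ?_).trans (image_id s)
      exact mul_rpow_leftInv hc hk (hs0 hv)
    have h := essSup_image_le (φ := ψ) (φ' := fun u => (c⁻¹) ^ k⁻¹ * (k⁻¹ * u ^ (k⁻¹ - 1))) him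
      (fun u hu => by
        obtain ⟨v, hv, rfl⟩ := hu
        have : 0 < v := hs0 hv
        exact hasDerivWithinAt_mul_rpow _ _ (by positivity) _)
      (by rwa [hψs]) (fun v => F (c * v ^ k))
    rw [hψs] at h
    refine h.trans (normOn_mono him fun u hu => ?_)
    obtain ⟨v, hv, rfl⟩ := hu
    simp only [Function.comp_apply, hψ]
    rw [mul_rpow_leftInv hc hk (hs0 hv)]
  · have hqp : 0 < q.toReal := ENNReal.toReal_pos hq0 hqt
    have hr : rinv q = q.toReal⁻¹ := by rw [rinv, ENNReal.toReal_inv]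
    have hr0 : 0 ≤ rinv q := by rw [hr]; positivity
    have hw : ∀ u : ℝ, 0 < u → ∀ y : ℝ≥0∞, (ENNReal.ofReal (u ^ (-rinv q)) * y) ^ q.toReal =
        ENNReal.ofReal u⁻¹ * y ^ q.toReal := fun u hu y => by
      rw [ENNReal.mul_rpow_of_nonneg _ _ hqp.le, ENNReal.ofReal_rpow_of_pos (by positivity),
        ← Real.rpow_mul hu.le, hr, neg_mul, inv_mul_cancel₀ hqp.ne', Real.rpow_neg_one]
    rw [normOn_eq_lintegral hq0 hqt, normOn_eq_lintegral hq0 hqt,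
      lintegral_image_eq_lintegral_abs_deriv_mul hs hd hinj,
      ← ENNReal.ofReal_rpow_of_pos hk, ← ENNReal.mul_rpow_of_nonneg _ _ hr0,
      ← lintegral_const_mul' _ _ ENNReal.ofReal_ne_top]
    congr 1
    refine setLIntegral_congr_fun hs fun v hv => ?_
    have hv : 0 < v := hs0 hv
    have key : ENNReal.ofReal |c * (k * v ^ (k - 1))| * ENNReal.ofReal (c * v ^ k)⁻¹ =
        ENNReal.ofReal k * ENNReal.ofReal v⁻¹ := by
      rw [← ENNReal.ofReal_mul (abs_nonneg _), ← ENNReal.ofReal_mul hk.le,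
        abs_of_pos (by positivity), Real.rpow_sub_one hv.ne']
      congr 1
      have : v ^ k ≠ 0 := (Real.rpow_pos_of_pos hv k).ne'
      field_simp
    rw [hw _ (by positivity), hw _ hv, ← mul_assoc (ENNReal.ofReal |_|), key, mul_assoc]

theorem image_mul_rpow_Ioo {c k : ℝ} (hc : 0 < c) (hk : 0 < k) {T : ℝ} (hT : 0 < T) :
    (fun v : ℝ => c * v ^ k) '' Ioo 0 T = Ioo 0 (c * T ^ k) := by
  ext u
  constructor
  · rintro ⟨v, hv, rfl⟩
    have := hv.1
    exact ⟨by positivity, mul_lt_mul_of_pos_left (Real.rpow_lt_rpow hv.1.le hv.2 hk) hc⟩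
  · rintro ⟨hu, huT⟩
    have huc : 0 < u / c := by positivity
    refine ⟨(u / c) ^ k⁻¹, ⟨by positivity, ?_⟩, ?_⟩
    · rw [Real.rpow_inv_lt_iff_of_pos huc.le hT.le hk, div_lt_iff₀ hc, mul_comm]
      exact huT
    · simp only
      rw [Real.rpow_inv_rpow huc.le hk.ne', mul_div_cancel₀ _ hc.ne']

theorem image_mul_rpow_Ioi {c k : ℝ} (hc : 0 < c) (hk : 0 < k) :
    (fun v : ℝ => c * v ^ k) '' Ioi 0 = Ioi 0 := by
  ext u
  constructor
  · rintro ⟨v, hv, rfl⟩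
    have : 0 < v := hv
    exact (by positivity : 0 < c * v ^ k)
  · intro hu
    have huc : 0 < u / c := div_pos hu hc
    refine ⟨(u / c) ^ k⁻¹, by simpa using Real.rpow_pos_of_pos huc _, ?_⟩
    simp only
    rw [Real.rpow_inv_rpow huc.le hk.ne', mul_div_cancel₀ _ hc.ne']

/-- A supremum of functions whose norms decay geometrically. -/
theorem exists_normOn_iSup_le (q : ℝ≥0∞) {ρ : ℝ≥0∞} (hρ : ρ < 1) :
    ∃ C : ℝ≥0, ∀ (s : Set ℝ) (F : ℕ → ℝ → ℝ≥0∞) (A : ℝ≥0∞),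
      (∀ n, AEMeasurable (F n) (volume.restrict s)) → (∀ n, normOn q s (F n) ≤ ρ ^ n * A) →
        normOn q s (fun u => ⨆ n, F n u) ≤ C * A := by
  rcases eq_or_ne q 0 with rfl | hq0
  · exact ⟨0, by simp [normOn]⟩
  rcases eq_or_ne q ∞ with rfl | hqt
  · refine ⟨1, fun s F A _ h => ?_⟩
    rw [ENNReal.coe_one, one_mul, normOn, eLpNorm_exponent_top]
    refine eLpNormEssSup_le_of_ae_enorm_bound ?_
    have hn : ∀ n, ∀ᵐ u ∂volume.restrict s, F n u ≤ A := fun n => by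
      filter_upwards [ae_le_eLpNormEssSup (f := F n) (μ := volume.restrict s)] with u hu
      refine hu.trans ?_
      rw [← eLpNorm_exponent_top]
      refine (h n).trans ?_
      calc ρ ^ n * A ≤ 1 * A := by gcongr; exact pow_le_one₀ zero_le hρ.le
        _ = A := one_mul A
    filter_upwards [ae_all_iff.2 hn] with u hu
    exact iSup_le hu
  · have hqp : 0 < q.toReal := ENNReal.toReal_pos hq0 hqt
    have hr : rinv q = q.toReal⁻¹ := by rw [rinv, ENNReal.toReal_inv]
    have hr0 : 0 ≤ rinv q := by rw [hr]; positivity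
    have hD : (1 - ρ ^ q.toReal)⁻¹ ^ rinv q ≠ ∞ := by
      refine ENNReal.rpow_ne_top_of_nonneg hr0 (ENNReal.inv_ne_top.2 ?_)
      exact (tsub_pos_of_lt (ENNReal.rpow_lt_one hρ hqp)).ne'
    refine ⟨((1 - ρ ^ q.toReal)⁻¹ ^ rinv q).toNNReal, fun s F A hF h => ?_⟩
    rw [ENNReal.coe_toNNReal hD, normOn_eq_lintegral hq0 hqt]
    -- Bounding the supremum by the sum of `q`-th powers replaces the triangle inequality, so `q <
    -- 1` needs no separate treatment.
    have hpt : ∀ u, (⨆ n, F n u) ^ q.toReal ≤ ∑' n, F n u ^ q.toReal := fun u => by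
      rw [← ENNReal.le_rpow_inv_iff hqp]
      refine iSup_le fun n => ?_
      rw [ENNReal.le_rpow_inv_iff hqp]
      exact ENNReal.le_tsum n
    have hn : ∀ n, ∫⁻ u in s, F n u ^ q.toReal ≤ (ρ ^ q.toReal) ^ n * A ^ q.toReal := fun n => by
      have := h n
      rw [normOn_eq_lintegral hq0 hqt, hr, ENNReal.rpow_inv_le_iff hqp,
        ENNReal.mul_rpow_of_nonneg _ _ hqp.le, ← ENNReal.rpow_natCast, ← ENNReal.rpow_mul,
        mul_comm (n : ℝ), ENNReal.rpow_mul, ENNReal.rpow_natCast] at this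
      exact this
    calc (∫⁻ u in s, (⨆ n, F n u) ^ q.toReal) ^ rinv q
        ≤ ((1 - ρ ^ q.toReal)⁻¹ * A ^ q.toReal) ^ rinv q := by
          refine ENNReal.rpow_le_rpow ?_ hr0
          refine (lintegral_mono hpt).trans ?_
          rw [lintegral_tsum fun n => (hF n).pow_const _, ← ENNReal.tsum_geometric,
            ← ENNReal.tsum_mul_right]
          exact ENNReal.tsum_le_tsum hn
      _ = _ := by
          rw [ENNReal.mul_rpow_of_nonneg _ _ hr0, hr, ENNReal.rpow_rpow_inv hqp.ne']

/-! ### A Hardy-type inequality -/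

theorem lintegral_Ioo_rpow_sub_one {δ : ℝ} (hδ : 0 < δ) {U : ℝ} (hU : 0 < U) :
    ∫⁻ v in Ioo 0 U, ENNReal.ofReal (v ^ (δ - 1)) = ENNReal.ofReal (U ^ δ / δ) := by
  rw [← ofReal_integral_eq_lintegral_ofReal]
  · rw [← integral_Ioc_eq_integral_Ioo, ← intervalIntegral.integral_of_le hU.le,
      integral_rpow (Or.inl (by linarith)), sub_add_cancel, Real.zero_rpow hδ.ne', sub_zero]
  · exact (intervalIntegral.integrableOn_Ioo_rpow_iff hU).2 (by linarith)
  · exact (ae_restrict_iff' measurableSet_Ioo).2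
      (Filter.Eventually.of_forall fun v hv => Real.rpow_nonneg hv.1.le _)

/-- The right-hand side separates `u`-dependent quantities from a pure power of `v`, whose `κ`-th
power `v^{δ-1}` is integrable at `0` when `δ > 0`. -/
theorem le_mul_iSup_dyadic {κ δ : ℝ} (hκ : 0 < κ) (hδ1 : δ < 1) {h : ℝ → ℝ≥0∞}
    (hh : Antitone h) {u v : ℝ} (hu : 0 < u) (hv : v ∈ Ioo 0 (u ^ κ)) :
    h v ≤ (⨆ n : ℕ, ENNReal.ofReal ((2 ^ δ) ^ n) *
      (ENNReal.ofReal (u / 2 ^ (n + 1)) * h ((u / 2 ^ (n + 1)) ^ κ))) *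
        ENNReal.ofReal (2 * u ^ (-δ) * v ^ ((δ - 1) / κ)) := by
  have hv0 : 0 < v := hv.1
  set y := v ^ κ⁻¹ / u with hy
  have hy0 : 0 < y := by positivity
  have hy1 : y < 1 := by
    rw [hy, div_lt_one hu, Real.rpow_inv_lt_iff_of_pos hv0.le hu.le hκ]
    exact hv.2
  -- The dyadic block `2^{-(n+1)} < v^{1/κ} / u ≤ 2^{-n}`: its lower end serves the monotonicity of
  -- `h`, its upper end the negative power `δ - 1`.
  obtain ⟨n, hn1, hn2⟩ := exists_nat_pow_near_of_lt_one hy0 hy1.le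
    (show (0 : ℝ) < 1 / 2 by norm_num) (by norm_num)
  have hmono : h v ≤ h ((u / 2 ^ (n + 1)) ^ κ) := by
    refine hh ?_
    rw [← Real.le_rpow_inv_iff_of_pos (by positivity) hv0.le hκ]
    have : v ^ κ⁻¹ = u * y := by rw [hy]; field_simp
    rw [this, div_eq_mul_inv]
    gcongr
    rw [one_div, inv_pow] at hn1
    exact hn1.le
  have hcoef : 1 ≤ (2 ^ δ) ^ n * (u / 2 ^ (n + 1)) * (2 * u ^ (-δ) * v ^ ((δ - 1) / κ)) := by
    have h1 : v ^ ((δ - 1) / κ) = (u * y) ^ (δ - 1) := by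
      have : u * y = v ^ κ⁻¹ := by rw [hy]; field_simp
      rw [this, ← Real.rpow_mul hv0.le]; congr 1; field_simp
    have h2 : ((1 / 2 : ℝ) ^ n) ^ (δ - 1) ≤ y ^ (δ - 1) :=
      Real.rpow_le_rpow_of_nonpos hy0 hn2 (by linarith)
    have h3 : ((1 / 2 : ℝ) ^ n) ^ (δ - 1) = 2 ^ n / (2 ^ δ) ^ n := by
      rw [Real.rpow_sub_one (by positivity), ← Real.rpow_natCast_mul (by norm_num),
        mul_comm (n : ℝ), Real.rpow_mul_natCast (by norm_num), one_div, Real.inv_rpow (by norm_num)]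
      rw [inv_pow, inv_pow]; field_simp
    have h4 : u ^ (-δ) = u⁻¹ * (u ^ (δ - 1))⁻¹ := by
      rw [← Real.rpow_neg hu.le, ← Real.rpow_neg_one, ← Real.rpow_add hu]; congr 1; ring
    rw [h1, Real.mul_rpow hu.le hy0.le, h4]
    have h5 : (u ^ (δ - 1)) ≠ 0 := (Real.rpow_pos_of_pos hu _).ne'
    have h6 : (0 : ℝ) < (2 ^ δ) ^ n := by positivity
    calc (1 : ℝ) = (2 ^ δ) ^ n * (1 / 2 ^ n) * (2 ^ n / (2 ^ δ) ^ n) := by field_simp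
      _ ≤ (2 ^ δ) ^ n * (1 / 2 ^ n) * y ^ (δ - 1) := by rw [← h3]; gcongr
      _ = _ := by rw [pow_succ]; field_simp
  calc h v = 1 * h v := (one_mul _).symm
    _ ≤ ENNReal.ofReal ((2 ^ δ) ^ n * (u / 2 ^ (n + 1)) * (2 * u ^ (-δ) * v ^ ((δ - 1) / κ))) *
        h ((u / 2 ^ (n + 1)) ^ κ) := by
        gcongr
        rw [← ENNReal.ofReal_one]
        exact ENNReal.ofReal_le_ofReal hcoef
    _ = (ENNReal.ofReal ((2 ^ δ) ^ n) *
          (ENNReal.ofReal (u / 2 ^ (n + 1)) * h ((u / 2 ^ (n + 1)) ^ κ))) *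
        ENNReal.ofReal (2 * u ^ (-δ) * v ^ ((δ - 1) / κ)) := by
        rw [ENNReal.ofReal_mul (by positivity), ENNReal.ofReal_mul (by positivity)]
        ring
    _ ≤ _ := by
        gcongr
        exact le_iSup (fun n : ℕ => ENNReal.ofReal ((2 ^ δ) ^ n) *
          (ENNReal.ofReal (u / 2 ^ (n + 1)) * h ((u / 2 ^ (n + 1)) ^ κ))) n

/-- Integrating the `κ`-th power of the dyadic majorant gives `u^{κδ} / δ`, which cancels the factor
`u^{-δκ}` and leaves the constant `2 δ^{-1/κ}`. -/
theorem powerMean_le_iSup {κ δ : ℝ} (hκ : 0 < κ) (hδ0 : 0 < δ) (hδ1 : δ < 1) {h : ℝ → ℝ≥0∞}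
    (hh : Antitone h) {u : ℝ} (hu : 0 < u) :
    powerMean κ h u ≤ ENNReal.ofReal (2 * δ⁻¹ ^ κ⁻¹) *
      ⨆ n : ℕ, ENNReal.ofReal ((2 ^ δ) ^ n) *
        (ENNReal.ofReal (u / 2 ^ (n + 1)) * h ((u / 2 ^ (n + 1)) ^ κ)) := by
  set M := ⨆ n : ℕ, ENNReal.ofReal ((2 ^ δ) ^ n) *
    (ENNReal.ofReal (u / 2 ^ (n + 1)) * h ((u / 2 ^ (n + 1)) ^ κ)) with hM
  rw [powerMean, ENNReal.rpow_inv_le_iff hκ]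
  have hpt : ∀ v ∈ Ioo 0 (u ^ κ), h v ^ κ ≤
      (M ^ κ * ENNReal.ofReal (2 ^ κ * u ^ (-δ * κ))) * ENNReal.ofReal (v ^ (δ - 1)) := by
    intro v hv
    have hv0 := hv.1
    refine (ENNReal.rpow_le_rpow (le_mul_iSup_dyadic hκ hδ1 hh hu hv) hκ.le).trans ?_
    rw [ENNReal.mul_rpow_of_nonneg _ _ hκ.le, ENNReal.ofReal_rpow_of_pos (by positivity),
      mul_assoc (M ^ κ), ← ENNReal.ofReal_mul (by positivity),
      Real.mul_rpow (by positivity) (by positivity), Real.mul_rpow (by positivity) (by positivity), ← Real.rpow_mul hu.le, ← Real.rpow_mul hv0.le,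
      div_mul_cancel₀ _ hκ.ne']
  refine (setLIntegral_mono' measurableSet_Ioo hpt).trans ?_
  rw [lintegral_const_mul _ (by fun_prop), lintegral_Ioo_rpow_sub_one hδ0 (by positivity),
    ENNReal.mul_rpow_of_nonneg _ _ hκ.le, ENNReal.ofReal_rpow_of_pos (by positivity), mul_assoc,
    ← ENNReal.ofReal_mul (by positivity), mul_comm]
  refine le_of_eq ?_
  congr 2
  rw [Real.mul_rpow (by positivity) (by positivity), Real.rpow_inv_rpow (by positivity) hκ.ne',
    ← Real.rpow_mul hu.le, neg_mul, Real.rpow_neg hu.le, mul_comm δ κ]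
  have : u ^ (κ * δ) ≠ 0 := (Real.rpow_pos_of_pos hu _).ne'
  field_simp

/-- A Potter-type bound, read off from the almost monotonicity of `t^{-ε} a(t)` between `v` and `l
v`. -/
theorem SlowlyVarying.exists_le_dilate {a : ℝ → ℝ} (ha : SlowlyVarying a) {ε : ℝ} (hε : 0 < ε) :
    ∃ C : ℝ, 0 < C ∧ ∀ l v : ℝ, 1 ≤ l → 0 < v → a (l * v) ≤ C * l ^ ε * a v := by
  obtain ⟨g, hg0, hganti, c, C, hc, hC, h⟩ := ha.equiv_anti ε hε
  refine ⟨C / c, by positivity, fun l v hl hv => ?_⟩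
  have hl0 : 0 < l := by linarith
  have hlv : 0 < l * v := by positivity
  have h1 := (h (l * v) hlv).2
  have h2 := (h v hv).1
  have h3 : g (l * v) ≤ g v := hganti hv hlv (by nlinarith)
  simp only at h1 h2
  rw [Real.mul_rpow hl0.le hv.le, Real.rpow_neg hl0.le, Real.rpow_neg hv.le] at h1
  rw [Real.rpow_neg hv.le] at h2
  have hle := Real.rpow_pos_of_pos hl0 ε
  have hve := Real.rpow_pos_of_pos hv ε
  have h4 : (l ^ ε)⁻¹ * (v ^ ε)⁻¹ * a (l * v) ≤ C / c * ((v ^ ε)⁻¹ * a v) := by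
    refine h1.trans ?_
    calc C * g (l * v) ≤ C * g v := by gcongr
      _ = C / c * (c * g v) := by field_simp
      _ ≤ _ := by gcongr
  calc a (l * v) = (l ^ ε * v ^ ε) * ((l ^ ε)⁻¹ * (v ^ ε)⁻¹ * a (l * v)) := by field_simp
    _ ≤ (l ^ ε * v ^ ε) * (C / c * ((v ^ ε)⁻¹ * a v)) := by gcongr
    _ = _ := by field_simp

theorem ofReal_rpow_sub_mul {σ τ u x : ℝ} (hu : 0 < u) :
    ENNReal.ofReal (u ^ (σ - τ) * x) =
      ENNReal.ofReal (u ^ (-τ)) * ENNReal.ofReal (u ^ σ * x) := by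
  rw [← ENNReal.ofReal_mul (by positivity), ← mul_assoc, ← Real.rpow_add hu, neg_add_eq_sub]

/-- After `u = l v` the weight `u^{-θ}` yields `l^{-θ}`, and slow variation of `a` costs only
`l^{θ/2}`. The interval shrinks to `(0, T/l) ⊆ (0, T)`, so the constant does not depend on `T`. -/
theorem SlowlyVarying.exists_normOn_dilate_le {a : ℝ → ℝ} (ha : SlowlyVarying a) {θ : ℝ}
    (hθ : 0 < θ) (q : ℝ≥0∞) :
    ∃ C : ℝ≥0, ∀ (G : ℝ → ℝ≥0∞) (T l : ℝ), 0 < T → 1 ≤ l →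
      normOn q (Ioo 0 T) (fun u => ENNReal.ofReal (u ^ (-θ - rinv q) * a u) * G (u / l)) ≤
        C * ENNReal.ofReal (l ^ (-(θ / 2))) *
          normOn q (Ioo 0 T) (fun u => ENNReal.ofReal (u ^ (-θ - rinv q) * a u) * G u) := by
  obtain ⟨C, hC, hCa⟩ := ha.exists_le_dilate (half_pos hθ)
  refine ⟨C.toNNReal, fun G T l hT hl => ?_⟩
  have hl0 : 0 < l := by linarith
  have hcast : (C.toNNReal : ℝ≥0∞) * ENNReal.ofReal (l ^ (-(θ / 2))) =
      ((C * l ^ (-(θ / 2))).toNNReal : ℝ≥0) := by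
    change ENNReal.ofReal C * _ = ENNReal.ofReal _
    rw [ENNReal.ofReal_mul hC.le]
  -- The exponent `1` presents the dilation as a case of the power substitution.
  have himg : Ioo 0 T = (fun v : ℝ => l * v ^ (1 : ℝ)) '' Ioo 0 (T / l) := by
    rw [image_mul_rpow_Ioo hl0 one_pos (by positivity), Real.rpow_one, mul_div_cancel₀ _ hl0.ne']
  have hsub : Ioo 0 (T / l) ⊆ Ioo 0 T := Ioo_subset_Ioo_right (div_le_self hT.le hl)
  rw [normOn_congr measurableSet_Ioo (g := fun u => ENNReal.ofReal (u ^ (-rinv q)) *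
    (ENNReal.ofReal (u ^ (-θ) * a u) * G (u / l)))
    fun u hu => by rw [ofReal_rpow_sub_mul hu.1, mul_assoc], himg,
    normOn_image_mul_rpow hl0 one_pos measurableSet_Ioo (fun u hu => hu.1), ← himg, Real.one_rpow,
    ENNReal.ofReal_one, one_mul, hcast]
  refine (normOn_le_mul measurableSet_Ioo fun v hv => ?_).trans
    (mul_le_mul_right (normOn_mono_set hsub _) _)
  have hv0 := hv.1
  have hav := ha.pos v hv0
  have hpt : ENNReal.ofReal ((l * v) ^ (-θ) * a (l * v)) ≤
      ENNReal.ofReal (C * l ^ (-(θ / 2))) * ENNReal.ofReal (v ^ (-θ) * a v) := by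
    rw [← ENNReal.ofReal_mul (by positivity)]
    refine ENNReal.ofReal_le_ofReal ?_
    have hll : l ^ (-θ) * l ^ (θ / 2) = l ^ (-(θ / 2)) := by
      rw [← Real.rpow_add hl0]; congr 1; ring
    calc (l * v) ^ (-θ) * a (l * v) ≤ (l * v) ^ (-θ) * (C * l ^ (θ / 2) * a v) := by
          gcongr; exact hCa l v hl hv0
      _ = C * (l ^ (-θ) * l ^ (θ / 2)) * (v ^ (-θ) * a v) := by
          rw [Real.mul_rpow hl0.le hv0.le]; ring
      _ = _ := by rw [hll]
  rw [ofReal_rpow_sub_mul hv0, Real.rpow_one, mul_div_cancel_left₀ _ hl0.ne']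
  calc _ ≤ ENNReal.ofReal (v ^ (-rinv q)) * (ENNReal.ofReal (C * l ^ (-(θ / 2))) *
          ENNReal.ofReal (v ^ (-θ) * a v) * G v) := by gcongr
    _ = ENNReal.ofReal (C * l ^ (-(θ / 2))) * (ENNReal.ofReal (v ^ (-rinv q)) *
          ENNReal.ofReal (v ^ (-θ) * a v) * G v) := by ring

theorem SlowlyVarying.exists_normOn_powerMean_le {a : ℝ → ℝ} (ha : SlowlyVarying a) {θ κ : ℝ}
    (hθ0 : 0 < θ) (hθ1 : θ ≤ 1) (hκ : 0 < κ) (q : ℝ≥0∞) :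
    ∃ C : ℝ≥0, ∀ h : ℝ → ℝ≥0∞, Antitone h → ∀ T : ℝ, 0 < T →
      normOn q (Ioo 0 T)
        (fun u => ENNReal.ofReal (u ^ (-θ - rinv q) * a u) * powerMean κ h u) ≤
      C * normOn q (Ioo 0 T) (fun u => ENNReal.ofReal (u ^ (-θ - rinv q) * a u) *
        (ENNReal.ofReal u * h (u ^ κ))) := by
  -- Dilation by `2^{n+1}` gains `2^{-(n+1)θ/2}`. With `δ = θ/4`, half of this absorbs `2^{δn}` and
  -- the other half leaves the ratio `2^{-δ}`; `θ ≤ 1` ensures `δ < 1`.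
  set δ := θ / 4 with hδ
  have hδ0 : 0 < δ := by positivity
  have hδ1 : δ < 1 := by linarith
  have hρ : ENNReal.ofReal (2 ^ (-δ)) < 1 := by
    rw [← ENNReal.ofReal_one, ENNReal.ofReal_lt_ofReal_iff one_pos]
    exact Real.rpow_lt_one_of_one_lt_of_neg one_lt_two (by linarith)
  obtain ⟨C₁, hC₁⟩ := ha.exists_normOn_dilate_le hθ0 q
  obtain ⟨C₂, hC₂⟩ := exists_normOn_iSup_le q hρ
  refine ⟨(2 * δ⁻¹ ^ κ⁻¹).toNNReal * (C₂ * C₁), fun h hh T hT => ?_⟩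
  set w : ℝ → ℝ≥0∞ := fun u => ENNReal.ofReal (u ^ (-θ - rinv q) * a u) with hw
  set G : ℝ → ℝ≥0∞ := fun u => ENNReal.ofReal u * h (u ^ κ) with hG
  set N := normOn q (Ioo 0 T) (fun u => w u * G u)
  have hGm : Measurable G :=
    ENNReal.measurable_ofReal.mul (hh.measurable.comp (by fun_prop))
  have hwm : AEMeasurable w (volume.restrict (Ioo 0 T)) := by
    refine ENNReal.measurable_ofReal.comp_aemeasurable (AEMeasurable.mul ?_ ?_)
    · exact (by fun_prop : Measurable fun u : ℝ => u ^ (-θ - rinv q)).aemeasurable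
    · exact ha.aemeasurable.mono_measure (Measure.restrict_mono (fun u hu => hu.1) le_rfl)
  let F : ℕ → ℝ → ℝ≥0∞ := fun n u =>
    w u * (ENNReal.ofReal ((2 ^ δ) ^ n) * G (u / 2 ^ (n + 1)))
  have hFm : ∀ n, AEMeasurable (F n) (volume.restrict (Ioo 0 T)) := fun n =>
    hwm.mul (((hGm.comp (measurable_id.div_const _)).const_mul _).aemeasurable)
  have hFn : ∀ n, normOn q (Ioo 0 T) (F n) ≤ ENNReal.ofReal (2 ^ (-δ)) ^ n * (C₁ * N) := by
    intro n
    have h2n : (1 : ℝ) ≤ 2 ^ (n + 1) := one_le_pow₀ one_le_two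
    have e1 : normOn q (Ioo 0 T) (F n) ≤ ((2 ^ δ) ^ n : ℝ).toNNReal *
        normOn q (Ioo 0 T) (fun u => w u * G (u / 2 ^ (n + 1))) :=
      normOn_le_mul measurableSet_Ioo fun u _ => le_of_eq (mul_left_comm _ _ _)
    refine e1.trans ((mul_le_mul_right (hC₁ G T _ hT h2n) _).trans ?_)
    have e2 : ENNReal.ofReal ((2 ^ δ) ^ n) * ENNReal.ofReal ((2 ^ (n + 1)) ^ (-(θ / 2))) ≤
        ENNReal.ofReal (2 ^ (-δ)) ^ n := by
      rw [← ENNReal.ofReal_mul (by positivity), ← ENNReal.ofReal_pow (by positivity)]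
      refine ENNReal.ofReal_le_ofReal ?_
      rw [← Real.rpow_mul_natCast zero_le_two, ← Real.rpow_mul_natCast zero_le_two,
        ← Real.rpow_natCast_mul zero_le_two, ← Real.rpow_add two_pos]
      refine Real.rpow_le_rpow_of_exponent_le one_le_two ?_
      push_cast
      nlinarith
    calc _ = (ENNReal.ofReal ((2 ^ δ) ^ n) * ENNReal.ofReal ((2 ^ (n + 1)) ^ (-(θ / 2)))) *
          (C₁ * N) := by
          change ENNReal.ofReal _ * _ = _
          ring
      _ ≤ _ := by gcongr
  have hsup := hC₂ (Ioo 0 T) F (C₁ * N) hFm hFn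
  have hmain : normOn q (Ioo 0 T) (fun u => w u * powerMean κ h u) ≤
      (2 * δ⁻¹ ^ κ⁻¹).toNNReal * normOn q (Ioo 0 T) (fun u => ⨆ n, F n u) := by
    refine normOn_le_mul measurableSet_Ioo fun u hu => ?_
    refine (mul_le_mul_right (powerMean_le_iSup hκ hδ0 hδ1 hh hu.1) _).trans (le_of_eq ?_)
    rw [mul_left_comm, ENNReal.mul_iSup]
    rfl
  calc _ ≤ _ := hmain
    _ ≤ ((2 * δ⁻¹ ^ κ⁻¹).toNNReal : ℝ≥0∞) * (C₂ * (C₁ * N)) := by gcongr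
    _ = _ := by push_cast; ring

/-! ### Comparison of the iterated norms -/

theorem leftNorm_le_mul {σ : ℝ} {r q : ℝ≥0∞} {a b : ℝ → ℝ} {g g' : ℝ → ℝ≥0∞} {C : ℝ≥0}
    (h : ∀ t : ℝ, 0 < t →
      normOn q (Ioo 0 t) (fun u => ENNReal.ofReal (u ^ (σ - rinv q) * a u) * g u) ≤
        C * normOn q (Ioo 0 t) (fun u => ENNReal.ofReal (u ^ (σ - rinv q) * a u) * g' u)) :
    leftNorm σ r b q a g ≤ C * leftNorm σ r b q a g' :=
  normOn_le_mul measurableSet_Ioi fun t ht => by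
    rw [mul_left_comm]
    exact mul_le_mul_right (h t ht) _

theorem leftNorm_mono {σ : ℝ} {r q : ℝ≥0∞} {a b : ℝ → ℝ} {g g' : ℝ → ℝ≥0∞}
    (h : ∀ u : ℝ, 0 < u → g u ≤ g' u) : leftNorm σ r b q a g ≤ leftNorm σ r b q a g' :=
  normOn_mono measurableSet_Ioi fun _ _ => mul_le_mul_right
    (normOn_mono measurableSet_Ioo fun u hu => mul_le_mul_right (h u hu.1) _) _

theorem ae_lt_top_of_normOn_lt_top {q : ℝ≥0∞} (hq : 0 < q) {s : Set ℝ} {f : ℝ → ℝ≥0∞}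
    (hf : AEMeasurable f (volume.restrict s)) (h : normOn q s f < ∞) :
    ∀ᵐ u ∂volume.restrict s, f u < ∞ := by
  rcases eq_or_ne q ∞ with rfl | hqt
  · rw [normOn, eLpNorm_exponent_top] at h
    filter_upwards [ae_le_eLpNormEssSup (f := f) (μ := volume.restrict s)] with u hu
    exact lt_of_le_of_lt hu h
  · have hqp : 0 < q.toReal := ENNReal.toReal_pos hq.ne' hqt
    rw [normOn_eq_lintegral hq.ne' hqt, rinv, ENNReal.toReal_inv,
      ENNReal.rpow_lt_top_iff_of_pos (by positivity)] at h
    filter_upwards [ae_lt_top' (hf.pow_const _) h.ne] with u hu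
    exact (ENNReal.rpow_lt_top_iff_of_pos hqp).1 hu

theorem exists_mem_lt_top {q : ℝ≥0∞} (hq : 0 < q) {s : Set ℝ} (hs : MeasurableSet s)
    (hs0 : volume s ≠ 0) {f : ℝ → ℝ≥0∞}
    (hf : AEMeasurable f (volume.restrict s)) (h : normOn q s f < ∞) : ∃ u ∈ s, f u < ∞ := by
  by_contra! hc
  have h1 := ae_lt_top_of_normOn_lt_top hq hf h
  rw [ae_restrict_iff' hs, ae_iff] at h1
  refine hs0 (measure_mono_null (fun u hu => ?_) h1)
  rw [mem_ofPred_eq, Classical.not_imp]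
  exact ⟨hu, not_lt.2 (hc u hu)⟩

theorem SlowlyVarying.aemeasurable_weight {a : ℝ → ℝ} (ha : SlowlyVarying a) (σ : ℝ) {s : Set ℝ}
    (hs : s ⊆ Ioi 0) :
    AEMeasurable (fun u : ℝ => ENNReal.ofReal (u ^ σ * a u)) (volume.restrict s) := by
  refine ENNReal.measurable_ofReal.comp_aemeasurable (AEMeasurable.mul ?_ ?_)
  · exact (by fun_prop : Measurable fun u : ℝ => u ^ σ).aemeasurable
  · exact ha.aemeasurable.mono_measure (Measure.restrict_mono hs le_rfl)

theorem monotone_normOn_Ioo (q : ℝ≥0∞) (f : ℝ → ℝ≥0∞) : Monotone fun t => normOn q (Ioo 0 t) f :=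
  fun _ _ h => normOn_mono_set (Ioo_subset_Ioo_right h) f

/-- A function with finite iterated norm is finite somewhere. -/
theorem exists_pos_lt_top_of_leftNorm_lt_top {σ : ℝ} {r q : ℝ≥0∞} (hr : 0 < r) (hq : 0 < q)
    {a b : ℝ → ℝ} (ha : SlowlyVarying a) (hb : SlowlyVarying b) {g : ℝ → ℝ≥0∞}
    (hg : AEMeasurable g (volume.restrict (Ioi 0)))
    (h : leftNorm σ r b q a g < ∞) : ∃ u : ℝ, 0 < u ∧ g u < ∞ := by
  obtain ⟨t, ht, hlt⟩ := exists_mem_lt_top hr measurableSet_Ioi (by simp)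
    ((hb.aemeasurable_weight _ subset_rfl).mul (monotone_normOn_Ioo q _).measurable.aemeasurable) h
  have ht0 : 0 < t := ht
  have hbt := hb.pos t ht
  have h1 : normOn q (Ioo 0 t)
      (fun u => ENNReal.ofReal (u ^ (σ - rinv q) * a u) * g u) < ∞ := by
    refine lt_of_not_ge fun hc => ?_
    simp only [top_le_iff] at hc
    rw [Pi.mul_apply, hc, ENNReal.mul_top (by simpa using by positivity)] at hlt
    exact lt_irrefl _ hlt
  obtain ⟨u, hu, hlt'⟩ := exists_mem_lt_top hq measurableSet_Ioo (by simpa using ht0)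
    ((ha.aemeasurable_weight _ fun u hu => hu.1).mul
      (hg.mono_measure (Measure.restrict_mono (fun u hu => hu.1) le_rfl))) h1
  have hu0 : 0 < u := hu.1
  have hau := ha.pos u hu0
  refine ⟨u, hu0, lt_of_not_ge fun hc => ?_⟩
  rw [Pi.mul_apply, top_le_iff.1 hc, ENNReal.mul_top (by simpa using by positivity)] at hlt'
  exact lt_irrefl _ hlt'

/-- The substitution `u = v ^ κ` in both norms. -/
theorem leftNorm_rpow {κ : ℝ} (hκ : 0 < κ) (θ : ℝ) (r q : ℝ≥0∞) (a b : ℝ → ℝ) (h : ℝ → ℝ≥0∞) :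
    leftNorm ((1 - θ) / κ) r (fun t => b (t ^ (1 / κ))) q (fun t => a (t ^ (1 / κ))) h =
      ENNReal.ofReal (κ ^ rinv r * κ ^ rinv q) *
        leftNorm (-θ) r b q a (fun u => ENNReal.ofReal u * h (u ^ κ)) := by
  have hin : ∀ t : ℝ, 0 < t →
      normOn q (Ioo 0 (t ^ κ)) (fun u =>
        ENNReal.ofReal (u ^ ((1 - θ) / κ - rinv q) * a (u ^ (1 / κ))) * h u) =
      (κ ^ rinv q).toNNReal * normOn q (Ioo 0 t) (fun u =>
        ENNReal.ofReal (u ^ (-θ - rinv q) * a u) * (ENNReal.ofReal u * h (u ^ κ))) := by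
    intro t ht
    have himg := image_mul_rpow_Ioo one_pos hκ ht
    rw [one_mul] at himg
    rw [normOn_congr measurableSet_Ioo (g := fun u => ENNReal.ofReal (u ^ (-rinv q)) *
      (ENNReal.ofReal (u ^ ((1 - θ) / κ) * a (u ^ (1 / κ))) * h u))
      fun u hu => by rw [ofReal_rpow_sub_mul hu.1, mul_assoc], ← himg,
      normOn_image_mul_rpow one_pos hκ measurableSet_Ioo (fun u hu => hu.1)]
    change _ = ENNReal.ofReal _ * _
    congr 1
    refine normOn_congr measurableSet_Ioo fun v hv => ?_
    have hv0 := hv.1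
    rw [ofReal_rpow_sub_mul hv0, mul_assoc, one_mul, one_div, Real.rpow_rpow_inv hv0.le hκ.ne',
      ← Real.rpow_mul hv0.le, mul_div_cancel₀ _ hκ.ne', sub_eq_neg_add, Real.rpow_add hv0,
      Real.rpow_one, mul_right_comm, ENNReal.ofReal_mul' hv0.le, mul_assoc]
  have himg := image_mul_rpow_Ioi one_pos hκ
  have hcq : (κ ^ rinv q).toNNReal ≠ 0 := by
    simpa using Real.rpow_pos_of_pos hκ (rinv q)
  have hcast : ((κ ^ rinv q).toNNReal : ℝ≥0∞) = ENNReal.ofReal (κ ^ rinv q) := rfl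
  rw [leftNorm, leftNorm, normOn_congr measurableSet_Ioi (g := fun t =>
    ENNReal.ofReal (t ^ (-rinv r)) * (ENNReal.ofReal (b (t ^ (1 / κ))) *
      normOn q (Ioo 0 t) (fun u =>
        ENNReal.ofReal (u ^ ((1 - θ) / κ - rinv q) * a (u ^ (1 / κ))) * h u)))
    fun t ht => by rw [ENNReal.ofReal_mul (Real.rpow_nonneg (le_of_lt ht) _), mul_assoc]]
  conv_lhs => rw [← himg]
  rw [normOn_image_mul_rpow one_pos hκ measurableSet_Ioi subset_rfl,
    ENNReal.ofReal_mul (by positivity), mul_assoc, ← hcast, ← normOn_const_mul measurableSet_Ioi hcq]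
  congr 1
  refine normOn_congr measurableSet_Ioi fun t ht => ?_
  have ht0 : 0 < t := ht
  rw [one_mul, hin t ht0, one_div, Real.rpow_rpow_inv ht0.le hκ.ne',
    ENNReal.ofReal_mul (by positivity)]
  ring

theorem slowlyVarying_one : SlowlyVarying fun _ => 1 where
  aemeasurable := aemeasurable_const
  pos _ _ := one_pos
  equiv_mono ε hε := ⟨fun t => t ^ ε, fun t ht => Real.rpow_pos_of_pos ht ε,
    fun s hs t _ hst => Real.rpow_le_rpow (le_of_lt hs) hst hε.le,
    1, 1, one_pos, one_pos, by simp⟩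
  equiv_anti ε hε := ⟨fun t => t ^ (-ε), fun t ht => Real.rpow_pos_of_pos ht _,
    fun s hs t _ hst => Real.rpow_le_rpow_of_nonpos hs hst (by linarith),
    1, 1, one_pos, one_pos, by simp⟩

/-- This includes `θ = 1`: division by zero in `ℝ≥0∞` gives `p = ∞`, and both sides are `0`. -/
theorem rinv_div {θ κ : ℝ} (hθ : θ ≤ 1) (hκ : 0 < κ) :
    rinv (ENNReal.ofReal κ / ENNReal.ofReal (1 - θ)) = (1 - θ) / κ := by
  have hκ0 : ENNReal.ofReal κ ≠ 0 := by simpa using hκ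
  rw [rinv, ENNReal.inv_div (Or.inl ENNReal.ofReal_ne_top) (Or.inr hκ0), ENNReal.toReal_div,
    ENNReal.toReal_ofReal hκ.le, ENNReal.toReal_ofReal (by linarith)]

/-! ### Identification of the interpolation spaces -/

section spaces

variable {Ω : Type*} [MeasurableSpace Ω] {μ : Measure Ω} {𝕜 : Type*} [RCLike 𝕜]

theorem isSum_weak_of_isSum {κ : ℝ} (hκ : 0 < κ) {f : Ω →ₘ[μ] 𝕜}
    (h : IsSum (Lebesgue μ 𝕜 (ENNReal.ofReal κ)) (Lebesgue μ 𝕜 ∞) f) :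
    IsSum (WeakLebesgue μ 𝕜 (ENNReal.ofReal κ)) (Lebesgue μ 𝕜 ∞) f :=
  let ⟨f₀, h₀, f₁, h₁, hf⟩ := h
  ⟨f₀, lebesgue_subset_weakLebesgue hκ h₀, f₁, h₁, hf⟩

theorem monotoneOn_powerMean {κ : ℝ} (hκ : 0 < κ) (h : ℝ → ℝ≥0∞) :
    MonotoneOn (powerMean κ h) (Ioi 0) := fun _ hs _ _ hst =>
  ENNReal.rpow_le_rpow (lintegral_mono_set
    (Ioo_subset_Ioo_right (Real.rpow_le_rpow (le_of_lt hs) hst hκ.le))) (inv_nonneg.2 hκ.le)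

theorem LKL_one (p r : ℝ≥0∞) (b : ℝ → ℝ) (q : ℝ≥0∞) :
    LKL μ 𝕜 p r b q (fun _ => 1) = SmallLK μ 𝕜 p q r b := by
  simp only [LKL, SmallLK, leftNorm, mul_one]

variable {θ κ : ℝ} {a b : ℝ → ℝ}

theorem exists_leftNorm_powerMean_le (hθ₀ : 0 < θ) (hθ₁ : θ ≤ 1) (hκ : 0 < κ)
    (q r : ℝ≥0∞) (ha : SlowlyVarying a) (b : ℝ → ℝ) :
    ∃ C : ℝ≥0, ∀ h : ℝ → ℝ≥0∞, Antitone h →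
      leftNorm (-θ) r b q a (powerMean κ h) ≤
        C * leftNorm (-θ) r b q a (fun u => ENNReal.ofReal u * h (u ^ κ)) := by
  obtain ⟨C, hC⟩ := ha.exists_normOn_powerMean_le hθ₀ hθ₁ hκ q
  exact ⟨C, fun h hh => leftNorm_le_mul fun t ht => hC h hh t ht⟩

variable [SigmaFinite μ]

/-- By the Hardy inequality the iterated norm of the power mean is finite, hence the power mean is
finite at some `u`, and the decomposition at that `u` applies. The Lorentz–Karamata space does not
presuppose membership in the sum, so this must be derived from the norm. -/
theorem isSum_of_leftNorm_lt_top (hθ₀ : 0 < θ) (hθ₁ : θ ≤ 1) (hκ : 0 < κ) {q r : ℝ≥0∞}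
    (hq : 0 < q) (hr : 0 < r) (ha : SlowlyVarying a) (hb : SlowlyVarying b) {f : Ω →ₘ[μ] 𝕜}
    (hf : leftNorm (-θ) r b q a (fun u => ENNReal.ofReal u * rearr f (u ^ κ)) < ∞) :
    IsSum (Lebesgue μ 𝕜 (ENNReal.ofReal κ)) (Lebesgue μ 𝕜 ∞) f := by
  obtain ⟨C, hC⟩ := exists_leftNorm_powerMean_le hθ₀ hθ₁ hκ q r ha b
  obtain ⟨u, hu, hlt⟩ := exists_pos_lt_top_of_leftNorm_lt_top hr hq ha hb
    (aemeasurable_restrict_of_monotoneOn measurableSet_Ioi (monotoneOn_powerMean hκ (rearr f)))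
    ((hC _ (rearr_antitone f)).trans_lt (ENNReal.mul_lt_top ENNReal.coe_lt_top hf))
  obtain ⟨f₀, h₀, f₁, h₁, h, -⟩ := exists_decomposition hκ f hu hlt
  exact ⟨f₀, h₀, f₁, h₁, h⟩

theorem exists_leftNorm_peetreK_le (hθ₀ : 0 < θ) (hθ₁ : θ ≤ 1) (hκ : 0 < κ)
    (q r : ℝ≥0∞) (ha : SlowlyVarying a) (b : ℝ → ℝ) :
    ∃ C : ℝ≥0, ∀ f : Ω →ₘ[μ] 𝕜, leftNorm (-θ) r b q a
        (fun u => peetreK (Lebesgue μ 𝕜 (ENNReal.ofReal κ)) (Lebesgue μ 𝕜 ∞) u f) ≤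
      C * leftNorm (-θ) r b q a (fun u => ENNReal.ofReal u * rearr f (u ^ κ)) := by
  obtain ⟨C, hC⟩ := exists_leftNorm_powerMean_le hθ₀ hθ₁ hκ q r ha b
  refine ⟨2 * C, fun f => ?_⟩
  have h2 : leftNorm (-θ) r b q a
      (fun u => peetreK (Lebesgue μ 𝕜 (ENNReal.ofReal κ)) (Lebesgue μ 𝕜 ∞) u f) ≤
      (2 : ℝ≥0) * leftNorm (-θ) r b q a (powerMean κ (rearr f)) :=
    leftNorm_le_mul fun t _ => normOn_le_mul measurableSet_Ioo fun u hu => by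
      rw [mul_left_comm]
      exact mul_le_mul_right (peetreK_le_powerMean hκ f hu.1) _
  calc _ ≤ _ := h2
    _ ≤ ((2 : ℝ≥0) : ℝ≥0∞) *
        (C * leftNorm (-θ) r b q a (fun u => ENNReal.ofReal u * rearr f (u ^ κ))) := by
        gcongr; exact hC _ (rearr_antitone f)
    _ = _ := by rw [← mul_assoc, ← ENNReal.coe_mul]

theorem interpL_lebesgue_same_interpL_weak (hθ₀ : 0 < θ) (hθ₁ : θ ≤ 1) (hκ : 0 < κ) {q r : ℝ≥0∞}
    (hq : 0 < q) (hr : 0 < r) (ha : SlowlyVarying a) (hb : SlowlyVarying b) :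
    (interpL (Lebesgue μ 𝕜 (ENNReal.ofReal κ)) (Lebesgue μ 𝕜 ∞) θ r b q a).Same
      (interpL (WeakLebesgue μ 𝕜 (ENNReal.ofReal κ)) (Lebesgue μ 𝕜 ∞) θ r b q a) := by
  have hle : ∀ f : Ω →ₘ[μ] 𝕜,
      (interpL (WeakLebesgue μ 𝕜 (ENNReal.ofReal κ)) (Lebesgue μ 𝕜 ∞) θ r b q a).qnorm f ≤
      (interpL (Lebesgue μ 𝕜 (ENNReal.ofReal κ)) (Lebesgue μ 𝕜 ∞) θ r b q a).qnorm f :=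
    fun f => leftNorm_mono fun u _ => peetreK_weak_le hκ f u
  have hG : ∀ f : Ω →ₘ[μ] 𝕜,
      leftNorm (-θ) r b q a (fun u => ENNReal.ofReal u * rearr f (u ^ κ)) ≤
      (interpL (WeakLebesgue μ 𝕜 (ENNReal.ofReal κ)) (Lebesgue μ 𝕜 ∞) θ r b q a).qnorm f :=
    fun f => leftNorm_mono fun u hu => mul_rearr_le_peetreK hκ f hu
  obtain ⟨C, hC⟩ := exists_leftNorm_peetreK_le (μ := μ) (𝕜 := 𝕜) hθ₀ hθ₁ hκ q r ha b
  refine ⟨⟨fun f hf => ⟨isSum_weak_of_isSum hκ hf.1, (hle f).trans_lt hf.2⟩, 1, fun f _ => ?_⟩,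
    fun f hf => ?_, C, fun f _ => (hC f).trans (mul_le_mul_right (hG f) _)⟩
  · rw [ENNReal.coe_one, one_mul]
    exact hle f
  · have hfin := (hG f).trans_lt hf.2
    exact ⟨isSum_of_leftNorm_lt_top hθ₀ hθ₁ hκ hq hr ha hb hfin,
      (hC f).trans_lt (ENNReal.mul_lt_top ENNReal.coe_lt_top hfin)⟩

theorem interpL_weak_same_LKL (hθ₀ : 0 < θ) (hθ₁ : θ ≤ 1) (hκ : 0 < κ) {q r : ℝ≥0∞}
    (hq : 0 < q) (hr : 0 < r) (ha : SlowlyVarying a) (hb : SlowlyVarying b) :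
    (interpL (WeakLebesgue μ 𝕜 (ENNReal.ofReal κ)) (Lebesgue μ 𝕜 ∞) θ r b q a).Same
      (LKL μ 𝕜 (ENNReal.ofReal κ / ENNReal.ofReal (1 - θ)) r (fun t => b (t ^ (1 / κ))) q
        (fun t => a (t ^ (1 / κ)))) := by
  -- The Jacobian factors of `u = v^κ` from the outer and the inner norm; the Lorentz–Karamata norm
  -- is exactly `c * G f`.
  set c : ℝ≥0 := (κ ^ rinv r * κ ^ rinv q).toNNReal
  have hc : c ≠ 0 := by
    simpa [c] using by positivity
  set G : (Ω →ₘ[μ] 𝕜) → ℝ≥0∞ := fun f =>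
    leftNorm (-θ) r b q a (fun u => ENNReal.ofReal u * rearr f (u ^ κ))
  have hL : ∀ f : Ω →ₘ[μ] 𝕜, (LKL μ 𝕜 (ENNReal.ofReal κ / ENNReal.ofReal (1 - θ)) r
      (fun t => b (t ^ (1 / κ))) q (fun t => a (t ^ (1 / κ)))).qnorm f = c * G f := fun f => by
    change leftNorm (rinv _) _ _ _ _ _ = _
    rw [rinv_div hθ₁ hκ, leftNorm_rpow hκ]
    rfl
  have hG : ∀ f : Ω →ₘ[μ] 𝕜, G f ≤
      (interpL (WeakLebesgue μ 𝕜 (ENNReal.ofReal κ)) (Lebesgue μ 𝕜 ∞) θ r b q a).qnorm f :=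
    fun f => leftNorm_mono fun u hu => mul_rearr_le_peetreK hκ f hu
  obtain ⟨C, hC⟩ := exists_leftNorm_peetreK_le (μ := μ) (𝕜 := 𝕜) hθ₀ hθ₁ hκ q r ha b
  have hK : ∀ f : Ω →ₘ[μ] 𝕜,
      (interpL (WeakLebesgue μ 𝕜 (ENNReal.ofReal κ)) (Lebesgue μ 𝕜 ∞) θ r b q a).qnorm f ≤
        C * G f := fun f => (leftNorm_mono fun u _ => peetreK_weak_le hκ f u).trans (hC f)
  refine ⟨⟨fun f hf => ?_, c, fun f _ => ?_⟩, fun f hf => ?_, C * c⁻¹, fun f _ => ?_⟩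
  · exact (hL f).trans_lt (ENNReal.mul_lt_top ENNReal.coe_lt_top ((hG f).trans_lt hf.2))
  · rw [hL]
    exact mul_le_mul_right (hG f) _
  · have hfin : c * G f < ∞ := (hL f).symm.trans_lt hf
    have hGf : G f < ∞ := ENNReal.lt_top_of_mul_ne_top_right hfin.ne (by simpa using hc)
    exact ⟨isSum_weak_of_isSum hκ (isSum_of_leftNorm_lt_top hθ₀ hθ₁ hκ hq hr ha hb hGf),
      (hK f).trans_lt (ENNReal.mul_lt_top ENNReal.coe_lt_top hGf)⟩
  · rw [hL, ← mul_assoc, ← ENNReal.coe_mul, mul_assoc, inv_mul_cancel₀ hc, mul_one]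
    exact hK f

end spaces

end LorentzKaramata

theorem theorem5p2 {Ω : Type*} [MeasurableSpace Ω] (μ : Measure Ω) [SigmaFinite μ]
    (hμ : LorentzKaramata.NonAtomic μ) (𝕜 : Type*) [RCLike 𝕜]
    (θ κ : ℝ) (hθ₀ : 0 < θ) (hθ₁ : θ ≤ 1) (hκ : 0 < κ)
    (p : ℝ≥0∞) (hp : p = ENNReal.ofReal κ / ENNReal.ofReal (1 - θ))
    (q r : ℝ≥0∞) (hq : 0 < q) (hr : 0 < r) (a b : ℝ → ℝ)
    (ha : LorentzKaramata.SlowlyVarying a) (hb : LorentzKaramata.SlowlyVarying b) :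
    let Lκ := LorentzKaramata.Lebesgue μ 𝕜 (ENNReal.ofReal κ)
    let Lκw := LorentzKaramata.WeakLebesgue μ 𝕜 (ENNReal.ofReal κ)
    let Linf := LorentzKaramata.Lebesgue μ 𝕜 ∞
    let a' : ℝ → ℝ := fun t => a (t ^ (1 / κ))
    let b' : ℝ → ℝ := fun t => b (t ^ (1 / κ))
    let one : ℝ → ℝ := fun _ => 1
    ((LorentzKaramata.interpL Lκ Linf θ r b q a).Same
        (LorentzKaramata.interpL Lκw Linf θ r b q a) ∧
      (LorentzKaramata.interpL Lκw Linf θ r b q a).Same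
        (LorentzKaramata.LKL μ 𝕜 p r b' q a')) ∧
    ((LorentzKaramata.interpL Lκ Linf θ r b q one).Same
        (LorentzKaramata.interpL Lκw Linf θ r b q one) ∧
      (LorentzKaramata.interpL Lκw Linf θ r b q one).Same
        (LorentzKaramata.SmallLK μ 𝕜 p q r b')) := by
  subst hp
  have h1 := LorentzKaramata.slowlyVarying_one
  refine ⟨⟨LorentzKaramata.interpL_lebesgue_same_interpL_weak hθ₀ hθ₁ hκ hq hr ha hb,
    LorentzKaramata.interpL_weak_same_LKL hθ₀ hθ₁ hκ hq hr ha hb⟩,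
    LorentzKaramata.interpL_lebesgue_same_interpL_weak hθ₀ hθ₁ hκ hq hr h1 hb, ?_⟩
  -- The constant weight `1` is unchanged by composition with `t ↦ t^{1/κ}`, so the general case
  -- applies with `a ≡ 1`.
  rw [← LorentzKaramata.LKL_one]
  exact LorentzKaramata.interpL_weak_same_LKL hθ₀ hθ₁ hκ hq hr h1 hb
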